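/- Fix the alphabet $\{a,b\}$. Write $\tilde m$ for the reversal of a finite word $m$; for a right-infinite word $\boldsymbol u=u_1u_2u_3\cdots$ let $\tilde{\boldsymbol u}=\cdots u_3u_2u_1$. A bi-infinite word $\boldsymbol s$ over $\{a,b\}$ satisfies the \emph{Markoff condition} if for each factorization $\boldsymbol s=\tilde{\boldsymbol u}\,xy\,\boldsymbol v$ with $\{x,y\}=\{a,b\}$ and right-infinite words $\boldsymbol u,\boldsymbol v$, one has either $\boldsymbol u=\boldsymbol v$, or $\boldsymbol u=my\boldsymbol u'$ and $\boldsymbol v=mx\boldsymbol v'$ for some finite (possibly empty) word $m$ and right-infinite words $\boldsymbol u',\boldsymbol v'$. A finite (possibly empty) word $m$ is a \emph{Markoff word} if there is a bi-infinite word $\boldsymbol s$ satisfying the Markoff condition with a factorization $\boldsymbol s=\tilde{\boldsymbol u}\,y\tilde m xy m x\,\boldsymbol v$, where $\{x,y\}=\{a,b\}$. For non-negative integers $p,q$ with $\gcd(p,q)=1$, let $\mathcal S$ be the line segment from $(0,0)$ to $(p,q)$ and let $\mathcal P$ be the lattice path from $(0,0)$ to $(p,q)$, with steps $(1,0)$ and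 $(0,1)$, that lies (weakly) below $\mathcal S$ and is such that the closed region enclosed by $\mathcal P$ and $\mathcal S$ contains no points of $\mathbb Z\times\mathbb Z$ besides those of $\mathcal P$. Encoding the steps $(1,0)$ by $a$ and $(0,1)$ by $b$ turns $\mathcal P$ into a word $L(p,q)$; the words $L(p,q)$ are the (lower) \emph{Christoffel words}. \textbf{Corollary.} A finite word $m$ over $\{a,b\}$ is a Markoff word if and only if $amb$ is a Christoffel word. -/

import Mathlib

namespace MarkoffWords

/-- The alphabet `{a, b}`. -/
inductive Letter where
  | a
  | b
  deriving DecidableEq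

/-- A finite word over `{a, b}`. -/
abbrev Word := List Letter

/-- A right-infinite word over `{a, b}`. -/
abbrev InfWord := Stream' Letter

/-- A bi-infinite word over `{a, b}`. -/
abbrev BiWord := ℤ → Letter

/-- `s = ũ w v`: the finite word `w` occurs in the bi-infinite word `s`, starting at some
position `i`; the right-infinite word `v` is what follows this occurrence, and the right-infinite
word `u` is what precedes it, read from right to left. -/
def Factorizes (s : BiWord) (u : InfWord) (w : Word) (v : InfWord) : Prop :=
  ∃ i : ℤ,
    (∀ k : ℕ, u.get k = s (i - 1 - k)) ∧
    (∀ (k : ℕ) (hk : k < w.length), w[k] = s (i + k)) ∧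
    (∀ k : ℕ, v.get k = s (i + w.length + k))

/-- The Markoff condition: for each factorization `s = ũ x y v` with `{x, y} = {a, b}`, either
`u = v`, or `u = m y u'` and `v = m x v'` for some finite word `m` and right-infinite words
`u'`, `v'`. -/
def MarkoffCondition (s : BiWord) : Prop :=
  ∀ (x y : Letter), x ≠ y → ∀ u v : InfWord, Factorizes s u [x, y] v →
    u = v ∨ ∃ (m : Word) (u' v' : InfWord),
      u = m ++ₛ Stream'.cons y u' ∧ v = m ++ₛ Stream'.cons x v'

/-- `m` is a Markoff word: some bi-infinite word satisfying the Markoff condition has a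
factorization `ũ y m̃ x y m x v` with `{x, y} = {a, b}`. -/
def IsMarkoffWord (m : Word) : Prop :=
  ∃ s : BiWord, MarkoffCondition s ∧ ∃ x y : Letter, x ≠ y ∧ ∃ u v : InfWord,
    Factorizes s u ([y] ++ m.reverse ++ [x, y] ++ m ++ [x]) v

/-- The point reached from the origin after the first `i` steps of the lattice path encoded by
`w`, where `a` is the step `(1, 0)` and `b` is the step `(0, 1)`. -/
def vertex (w : Word) (i : ℕ) : ℝ × ℝ :=
  (((w.take i).count Letter.a : ℝ), ((w.take i).count Letter.b : ℝ))

/-- The lattice path encoded by `w`, as a subset of the plane: the union of its unit steps. -/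
def path (w : Word) : Set (ℝ × ℝ) :=
  {z | ∃ i < w.length, z ∈ segment ℝ (vertex w i) (vertex w (i + 1))}

/-- The line segment from the origin to `(p, q)`. -/
def slopeSegment (p q : ℕ) : Set (ℝ × ℝ) := segment ℝ (0, 0) ((p : ℝ), (q : ℝ))

/-- `z` lies on or below a point of the set `S`. -/
def Below (z : ℝ × ℝ) (S : Set (ℝ × ℝ)) : Prop := ∃ y : ℝ, z.2 ≤ y ∧ (z.1, y) ∈ S

/-- `z` lies on or above a point of the set `S`. -/
def Above (z : ℝ × ℝ) (S : Set (ℝ × ℝ)) : Prop := ∃ y : ℝ, y ≤ z.2 ∧ (z.1, y) ∈ S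

/-- The (closed) region between the path encoded by `w` and the segment from the origin to
`(p, q)` above it. -/
def enclosedRegion (w : Word) (p q : ℕ) : Set (ℝ × ℝ) :=
  {z | Above z (path w) ∧ Below z (slopeSegment p q)}

/-- `w = L(p, q)`: the path encoded by `w` leads from the origin to `(p, q)`, lies below the
segment from the origin to `(p, q)`, and the region which the two enclose contains no points of
`ℤ × ℤ` besides those of the path. -/
structure EncodesLowerPath (w : Word) (p q : ℕ) : Prop where
  endpoint : vertex w w.length = ((p : ℝ), (q : ℝ))
  below : ∀ z ∈ path w, Below z (slopeSegment p q)
  no_other_points : ∀ X Y : ℤ,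
    ((X : ℝ), (Y : ℝ)) ∈ enclosedRegion w p q → ((X : ℝ), (Y : ℝ)) ∈ path w

/-- `w` is a (lower) Christoffel word. -/
def IsChristoffelWord (w : Word) : Prop :=
  ∃ p q : ℕ, Nat.Coprime p q ∧ EncodesLowerPath w p q

end MarkoffWords

/-!
A bi-infinite word `s` is studied through a function `H : ℤ → ℤ` counting its letters `b`, so that
every property of its factors becomes an inequality between values of `H`. The link between the two
sides of the equivalence is balance: `s` is balanced if any two factors of the same length differ by
at most one in their number of letters `b`.

*Markoff implies balanced* (`no_closest_unbalanced_pair`, `balancedAt_of_noJump`). If balance fails,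
take the least length `l` at which it does, and two factors of length `l` with `k` and `k + 2`
letters `b` as close to each other as possible. The first of them (after exchanging the letters if
necessary) is a palindrome `awa`, it is followed by `b`, and `s` has period `l` between the two.
Reflecting at this occurrence of `ab`, the Markoff condition carries the period over to the left
until it meets a factor with `k + 2` letters `b` that is closer to `awa` than the second one.

*Balanced implies Markoff* (`markoffCondition_of_balanced`) is immediate: a violation consists of
two factors `x m̃ x` and `y m y` with `{x, y} = {a, b}`.

*From `m` to a Christoffel word* (`strict_bounds_of_balanced`). Let `n` be the length of `amb`, `q`
its number of letters `b` and `f t` the number of letters `b` in its prefix of length `t`. If a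
balanced word contains `y m̃ xy m x`, then for `0 < t < n` all its factors of length `t` contain
`f t` or `f t + 1` letters `b`, and both values occur among `n` consecutive windows with sum `t * q`.
Hence `f t < t * q / n < f t + 1`. These strict bounds say that `amb` encodes the highest lattice
path below the segment and that the segment has no inner lattice points, which makes `amb` a
Christoffel word (`isChristoffelWord_of_count_bounds`).

*From a Christoffel word to `m`* (`isMarkoffWord_of_isChristoffelWord`). A Christoffel word `amb` has
`⌊t * q / n⌋` letters `b` in its prefix of length `t` (`EncodesLowerPath.count_bounds`). Its periodic
repetition is the mechanical word of slope `q / n`, which is balanced; `m` is a palindrome because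
`q` and `n` are coprime, so the repetition contains `ambamb = a m̃ ba m b`.
-/

namespace MarkoffWords

/-! ### Counting functions and balance -/

/-- The number of occurrences of `b` in a one-letter word, as an integer. -/
def Letter.weight : Letter → ℤ
  | .a => 0
  | .b => 1

/-- `H` counts the letters `b` of the bi-infinite word `s`: the factor of `s` at the positions
`i, …, j - 1` contains `H j - H i` letters `b`. -/
def Counts (H : ℤ → ℤ) (s : BiWord) : Prop :=
  ∀ i, H (i + 1) = H i + (s i).weight

/-- `H` is nondecreasing with increments `0` and `1`, that is, it counts the letters `b` of some
bi-infinite word. -/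
def UnitSteps (H : ℤ → ℤ) : Prop :=
  ∀ i, H i ≤ H (i + 1) ∧ H (i + 1) ≤ H i + 1

/-- Any two factors of length `l` of the word counted by `H` differ by at most one in their
number of letters `b`. -/
def BalancedAt (H : ℤ → ℤ) (l : ℕ) : Prop :=
  ∀ i j : ℤ, (H (i + l) - H i) - (H (j + l) - H j) ≤ 1

/-- One half of the Markoff condition, in terms of counting functions: at an occurrence of `ab`
around the position `c`, the second difference `H (c + t) + H (c - t) - 2 * H c`, which is `1` for
`t = 1`, cannot jump to `2` the first time it changes. The other half, for `ba`, is the same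
property of `fun i => i - H i`, which counts the letters `a`. -/
def NoJump (H : ℤ → ℤ) : Prop :=
  ∀ (c : ℤ) (T : ℕ), 1 ≤ T →
    (∀ t : ℕ, 1 ≤ t → t ≤ T → H (c + t) + H (c - t) - 2 * H c = 1) →
    H (c + T + 1) + H (c - T - 1) - 2 * H c ≠ 2

theorem exists_counts (s : BiWord) : ∃ H : ℤ → ℤ, Counts H s := by
  refine ⟨fun i => match i with
    | Int.ofNat n => ∑ k ∈ Finset.range n, (s k).weight
    | Int.negSucc n => -∑ k ∈ Finset.range (n + 1), (s (Int.negSucc k)).weight, ?_⟩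
  rintro (n | _ | n)
  · exact Finset.sum_range_succ _ n
  · change (0 : ℤ) = _
    simp
  · change -∑ k ∈ Finset.range (n + 1), (s (Int.negSucc k)).weight
      = -∑ k ∈ Finset.range (n + 1 + 1), (s (Int.negSucc k)).weight + (s (Int.negSucc (n + 1))).weight
    rw [Finset.sum_range_succ _ (n + 1)]
    ring

theorem Letter.weight_mem (x : Letter) : x.weight = 0 ∨ x.weight = 1 := by
  cases x <;> simp [Letter.weight]

theorem Letter.weight_injective : Function.Injective Letter.weight := by
  intro x y h
  cases x <;> cases y <;> simp_all [Letter.weight]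

theorem Counts.unitSteps {H : ℤ → ℤ} {s : BiWord} (h : Counts H s) : UnitSteps H := by
  intro i
  have := h i
  have := (s i).weight_mem
  omega

theorem UnitSteps.compl {H : ℤ → ℤ} (h : UnitSteps H) : UnitSteps (fun i => i - H i) := by
  intro i
  have := h i
  dsimp only
  omega

theorem BalancedAt.compl {H : ℤ → ℤ} {l : ℕ} (h : BalancedAt H l) :
    BalancedAt (fun i => i - H i) l := by
  intro i j
  have := h j i
  dsimp only
  omega

theorem BalancedAt.reflect {H : ℤ → ℤ} {l : ℕ} (h : BalancedAt H l) :
    BalancedAt (fun i => -H (-i)) l := by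
  intro i j
  have := h (-(i + l)) (-(j + l))
  have e₁ : -(i + (l : ℤ)) + l = -i := by ring
  have e₂ : -(j + (l : ℤ)) + l = -j := by ring
  rw [e₁, e₂] at this
  dsimp only
  omega

/-! ### The Markoff condition implies balance -/

/-- Suppose that `l` is the least length at which balance fails, and that the factors of length `l`
at `i` and `i + D` contain `k` and `k + 2` letters `b`, no two such factors being closer to each
other than `D`. By minimality of `l` the factor at `i` is a palindrome `awa`, followed by `b`; by
minimality of `D` the word has period `l` from `i + 1` up to the factor at `i + D`. Reflecting
at the occurrence of `ab` around `i + l`, the Markoff condition forces this period on the left of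
`i` too, up to a factor of length `l` with `k + 2` letters `b` that is closer to `i`. -/
theorem no_closest_unbalanced_pair {H : ℤ → ℤ} (hs : UnitSteps H) (hM : NoJump H) {l : ℕ}
    (hl : ∀ l' < l, BalancedAt H l') {i k : ℤ} {D : ℕ}
    (hi : H (i + l) - H i = k) (hj : H (i + D + l) - H (i + D) = k + 2)
    (hD : ∀ D' < D, ∀ p : ℤ,
      (H (p + D' + l) - H (p + D')) - (H (p + l) - H p) ≠ 2 ∧
      (H (p + D' + l) - H (p + D')) - (H (p + l) - H p) ≠ -2) : False := by
  have hl2 : 2 ≤ l := by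
    by_contra hlt
    obtain rfl | rfl : l = 0 ∨ l = 1 := by omega
    · simp only [Nat.cast_zero, add_zero] at hi hj
      omega
    · have := hs i
      have := hs (i + D)
      simp only [Nat.cast_one] at hi hj
      omega
  -- Minimality of `l` bounds the spread of the counts at length `l` by two.
  have spread : ∀ p q : ℤ, (H (p + l) - H p) - (H (q + l) - H q) ≤ 2 := by
    intro p q
    have h1 := hl (l - 1) (by omega) p q
    have h2 := hs (p + (l - 1 : ℕ))
    have h3 := hs (q + (l - 1 : ℕ))
    have e₁ : p + ((l - 1 : ℕ) : ℤ) + 1 = p + l := by omega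
    have e₂ : q + ((l - 1 : ℕ) : ℤ) + 1 = q + l := by omega
    rw [e₁] at h2
    rw [e₂] at h3
    omega
  have hD2 : 2 ≤ D := by
    by_contra hlt
    obtain rfl | rfl : D = 0 ∨ D = 1 := by omega
    · simp only [Nat.cast_zero, add_zero] at hj
      omega
    · have h1 := hs i
      have h2 := hs (i + l)
      have e₁ : i + ((1 : ℕ) : ℤ) + l = i + l + 1 := by push_cast; ring
      rw [e₁, Nat.cast_one] at hj
      omega
  have middle : ∀ t : ℕ, 1 ≤ t → t < D → H (i + l + t) = H (i + t) + k + 1 := by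
    intro t ht1 htD
    have h1 := hD t htD i
    have h2 := hD (D - t) (by omega) (i + t)
    have e₁ : i + (t : ℤ) + ((D - t : ℕ) : ℤ) = i + D := by omega
    rw [e₁] at h2
    have h3 := spread (i + t) i
    have h4 := spread (i + D) (i + t)
    have e₂ : i + (l : ℤ) + t = i + t + l := by ring
    rw [e₂]
    omega
  -- The factor of length `l` at `i` is a palindrome.
  have palin : ∀ t : ℕ, t ≤ l → H (i + t) + H (i + l - t) = 2 * H i + k := by
    intro t ht
    obtain rfl | rfl | ht' : t = 0 ∨ t = l ∨ (1 ≤ t ∧ t < l) := by omega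
    · simp only [Nat.cast_zero, add_zero, sub_zero]
      omega
    · have e : i + (t : ℤ) - t = i := by ring
      rw [e]
      omega
    · have h1 := hl t ht'.2 (i + D + l - t) i
      have h2 := hl (l - t) (by omega) (i + D) (i + t)
      have h3 := hl t ht'.2 (i + D + l - t) (i + l - t)
      have h4 := hl (l - t) (by omega) (i + D) i
      have e₁ : i + (D : ℤ) + l - t + t = i + D + l := by ring
      have e₂ : i + (D : ℤ) + ((l - t : ℕ) : ℤ) = i + D + l - t := by omega
      have e₃ : i + (t : ℤ) + ((l - t : ℕ) : ℤ) = i + l := by omega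
      have e₄ : i + (l : ℤ) - t + t = i + l := by ring
      have e₅ : i + ((l - t : ℕ) : ℤ) = i + l - t := by omega
      rw [e₁] at h1
      rw [e₂, e₃] at h2
      rw [e₁, e₄] at h3
      rw [e₂, e₅] at h4
      omega
  -- The second difference at `i + l` is `1` up to the distance `l`, or up to `D` if `D ≤ l`.
  have first : ∀ t : ℕ, 1 ≤ t → t ≤ l → t < D →
      H (i + l + t) + H (i + l - t) - 2 * H (i + l) = 1 := by
    intro t h1 h2 h3
    have := middle t h1 h3
    have := palin t h2
    omega
  have last : H (i + l + D) = H (i + D) + k + 2 := by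
    have e : i + (l : ℤ) + D = i + D + l := by ring
    rw [e]
    omega
  have eD₁ : i + (l : ℤ) + ((D - 1 : ℕ) : ℤ) + 1 = i + l + D := by omega
  have eD₂ : i + (l : ℤ) - ((D - 1 : ℕ) : ℤ) - 1 = i + l - D := by omega
  have hlD : l < D := by
    by_contra hDl
    have h1 := hM (i + l) (D - 1) (by omega) fun t h1 h2 => first t h1 (by omega) (by omega)
    rw [eD₁, eD₂] at h1
    have := palin D (by omega)
    omega
  have all : ∀ t : ℕ, t < D → ∀ t' : ℕ, 1 ≤ t' → t' ≤ t →
      H (i + l + t') + H (i + l - t') - 2 * H (i + l) = 1 := by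
    intro t
    induction t with
    | zero => omega
    | succ t ih =>
      intro htD t' h1 h2
      have ih := ih (by omega)
      obtain h3 | rfl : t' ≤ t ∨ t' = t + 1 := by omega
      · exact ih t' h1 h3
      by_cases htl : t + 1 ≤ l
      · exact first _ (by omega) htl htD
      -- By periodicity on the right, the second difference at `t + 1` is `0` only if the window
      -- of length `l` at `i + l - t - 1` contains `k + 2` letters `b`.
      have h4 := hM (i + l) t (by omega) ih
      have h5 := ih (t + 1 - l) (by omega) (by omega)
      have h6 := middle (t + 1) (by omega) htD
      have h7 := (hD (t + 1 - l) (by omega) (i + l - (t + 1 : ℕ))).2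
      have h8 := hs (i + l + t)
      have h9 := hs (i + l - t - 1)
      have h10 := ih t (by omega) le_rfl
      have e₁ : i + (l : ℤ) + ((t + 1 - l : ℕ) : ℤ) = i + (t + 1 : ℕ) := by omega
      have e₂ : i + (l : ℤ) - ((t + 1 : ℕ) : ℤ) + ((t + 1 - l : ℕ) : ℤ) = i := by omega
      have e₃ : i + (l : ℤ) - ((t + 1 - l : ℕ) : ℤ) = i + l - (t + 1 : ℕ) + l := by omega
      have e₄ : i + (l : ℤ) + t + 1 = i + l + (t + 1 : ℕ) := by push_cast; ring
      have e₅ : i + (l : ℤ) - t - 1 = i + l - (t + 1 : ℕ) := by push_cast; ring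
      have e₆ : i + (l : ℤ) - t - 1 + 1 = i + l - t := by ring
      rw [e₁, e₃] at h5
      rw [e₂] at h7
      rw [e₄] at h8 h4
      rw [e₆, e₅] at h9
      rw [e₅] at h4
      omega
  -- The period ends on the right at `i + D`, so a window with `k + 2` letters `b` occurs on the
  -- left at `i + l - D`, at the distance `D - l` from `i`.
  have h1 := hM (i + l) (D - 1) (by omega) (all (D - 1) (by omega))
  have h2 := all (D - 1) (by omega) (D - l) (by omega) (by omega)
  have h3 := (hD (D - l) (by omega) (i + l - D)).2
  have h4 := spread (i + l - D) i
  have h5 := hs (i + l + (D - 1 : ℕ))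
  have h6 := hs (i + l - (D - 1 : ℕ) - 1)
  have h7 := all (D - 1) (by omega) (D - 1) (by omega) le_rfl
  have e₁ : i + (l : ℤ) + ((D - l : ℕ) : ℤ) = i + D := by omega
  have e₂ : i + (l : ℤ) - D + ((D - l : ℕ) : ℤ) = i := by omega
  have e₃ : i + (l : ℤ) - ((D - l : ℕ) : ℤ) = i + l - D + l := by omega
  have e₄ : i + (l : ℤ) - ((D - 1 : ℕ) : ℤ) - 1 + 1 = i + l - (D - 1 : ℕ) := by ring
  rw [eD₁, eD₂] at h1
  rw [e₁, e₃] at h2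
  rw [e₂] at h3
  rw [eD₁] at h5
  rw [e₄, eD₂] at h6
  omega

theorem balancedAt_of_noJump {H : ℤ → ℤ} (hs : UnitSteps H) (hM : NoJump H)
    (hM' : NoJump fun i => i - H i) (l : ℕ) : BalancedAt H l := by
  induction l using Nat.strong_induction_on with
  | _ l ih =>
  by_contra hl
  have hex : ∃ D : ℕ, ∃ p : ℤ,
      (H (p + D + l) - H (p + D)) - (H (p + l) - H p) = 2 ∨
      (H (p + D + l) - H (p + D)) - (H (p + l) - H p) = -2 := by
    unfold BalancedAt at hl
    push Not at hl
    obtain ⟨i, j, hij⟩ := hl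
    have hl0 : l ≠ 0 := by
      rintro rfl
      simp at hij
    -- Balance at length `l - 1` gives a difference of exactly two.
    have hij' : (H (i + l) - H i) - (H (j + l) - H j) = 2 := by
      have h1 := ih (l - 1) (by omega) i j
      have h2 := hs (i + (l - 1 : ℕ))
      have h3 := hs (j + (l - 1 : ℕ))
      have e₁ : i + ((l - 1 : ℕ) : ℤ) + 1 = i + l := by omega
      have e₂ : j + ((l - 1 : ℕ) : ℤ) + 1 = j + l := by omega
      rw [e₁] at h2
      rw [e₂] at h3
      omega
    rcases le_total i j with h | h
    · refine ⟨(j - i).toNat, i, Or.inr ?_⟩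
      have e : i + ((j - i).toNat : ℤ) = j := by omega
      rw [e]
      omega
    · refine ⟨(i - j).toNat, j, Or.inl ?_⟩
      have e : j + ((i - j).toNat : ℤ) = i := by omega
      rw [e]
      omega
  classical
  have hmin : ∀ D' < Nat.find hex, ∀ p : ℤ,
      (H (p + D' + l) - H (p + D')) - (H (p + l) - H p) ≠ 2 ∧
      (H (p + D' + l) - H (p + D')) - (H (p + l) - H p) ≠ -2 := by
    intro D' hD' p
    have := Nat.find_min hex hD'
    push Not at this
    exact this p
  obtain ⟨p, hp | hp⟩ := Nat.find_spec hex
  · exact no_closest_unbalanced_pair hs hM ih (k := H (p + l) - H p) rfl (by omega) hmin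
  · refine no_closest_unbalanced_pair hs.compl hM' (fun l' hl' => (ih l' hl').compl)
      (i := p) (D := Nat.find hex) (k := l - (H (p + l) - H p)) ?_ ?_ ?_
    · omega
    · omega
    · intro D' hD' q
      have := hmin D' hD' q
      omega

/-! ### The Markoff condition in terms of positions -/

theorem _root_.Stream'.get_append_cons_length {α : Type*} (m : List α) (y : α)
    (u : Stream' α) : (m ++ₛ Stream'.cons y u).get m.length = y := by
  simp [Stream'.get_append_length]

/-- The Markoff condition states that, going outwards from an occurrence of `xy`, the first pair of
distinct letters is not `x` on the left and `y` on the right. -/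
theorem markoffCondition_iff (s : BiWord) : MarkoffCondition s ↔
    ∀ (c : ℤ) (T : ℕ), s (c - 1) ≠ s c → (∀ t < T, s (c - 2 - t) = s (c + 1 + t)) →
      ¬ (s (c - 2 - T) = s (c - 1) ∧ s (c + 1 + T) = s c) := by
  constructor
  · rintro h c T hc hT ⟨hx, hy⟩
    set u : InfWord := fun k => s (c - 2 - k) with hu
    set v : InfWord := fun k => s (c + 1 + k) with hv
    have hF : Factorizes s u [s (c - 1), s c] v := by
      refine ⟨c - 1, fun k => ?_, fun k hk => ?_, fun k => ?_⟩
      · change s _ = s _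
        congr 1
        ring
      · simp only [List.length_cons, List.length_nil] at hk
        obtain rfl | rfl : k = 0 ∨ k = 1 := by omega
        · simp
        · simp
      · change s _ = s _
        congr 1
        simp only [List.length_cons, List.length_nil]
        push_cast
        ring
    have huT : u.get T = s (c - 1) := hx
    have hvT : v.get T = s c := hy
    rcases h _ _ hc u v hF with huv | ⟨m, u', v', h1, h2⟩
    · exact hc (by rw [← huT, ← hvT, huv])
    · rcases lt_trichotomy T m.length with hlt | heq | hgt
      · refine hc ?_
        rw [← huT, ← hvT, h1, h2, Stream'.get_append_left _ _ _ hlt,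
          Stream'.get_append_left _ _ _ hlt]
      · rw [h1, heq, Stream'.get_append_cons_length] at huT
        exact hc huT.symm
      · have h3 : u.get m.length = v.get m.length := hT _ hgt
        rw [h1, h2, Stream'.get_append_cons_length,
          Stream'.get_append_cons_length] at h3
        exact hc h3.symm
  · rintro h x y hxy u v ⟨i, hu, hw, hv⟩
    have hx : s i = x := by simpa using (hw 0 (by simp)).symm
    have hy : s (i + 1) = y := by simpa using (hw 1 (by simp)).symm
    have hu' : ∀ k : ℕ, u.get k = s (i + 1 - 2 - k) := by
      intro k
      rw [hu]
      congr 1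
      ring
    have hv' : ∀ k : ℕ, v.get k = s (i + 1 + 1 + k) := by
      intro k
      rw [hv]
      congr 1
      simp only [List.length_cons, List.length_nil]
      push_cast
      ring
    by_cases huv : u = v
    · exact Or.inl huv
    · right
      have hex : ∃ T, u.get T ≠ v.get T := by
        by_contra hcon
        push Not at hcon
        exact huv (Stream'.ext hcon)
      classical
      have hT := Nat.find_spec hex
      have hlt : ∀ t < Nat.find hex, u.get t = v.get t := fun t ht => by
        simpa using Nat.find_min hex ht
      generalize Nat.find hex = T at hT hlt
      have hnot := h (i + 1) T (by rw [add_sub_cancel_right, hx, hy]; exact hxy)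
        (fun t ht => by rw [← hu', ← hv']; exact hlt t ht)
      rw [← hu', ← hv', add_sub_cancel_right, hx, hy] at hnot
      -- The alphabet has two letters, so two distinct letters are `x, y` in some order.
      have hyx : u.get T = y ∧ v.get T = x := by
        generalize u.get T = p at *
        generalize v.get T = q at *
        clear hu hv hw hu' hv' hx hy hlt h huv hex
        cases x <;> cases y <;> cases p <;> cases q <;> simp_all
      have htake : v.take T = u.take T := by
        refine List.ext_getElem (by simp) fun k h1 h2 => ?_
        simp only [Stream'.length_take] at h1
        simpa using (hlt k h1).symm
      have split : ∀ r : InfWord,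
          r = r.take T ++ₛ Stream'.cons (r.get T) (r.drop (T + 1)) := by
        intro r
        conv_lhs => rw [← Stream'.append_take_drop T r]
        congr 1
        rw [← Stream'.head_drop, ← Stream'.tail_drop']
        exact (Stream'.eta _).symm
      refine ⟨u.take T, u.drop (T + 1), v.drop (T + 1), ?_, ?_⟩
      · rw [← hyx.1]
        exact split u
      · rw [← hyx.2, ← htake]
        exact split v

theorem MarkoffCondition.noJump {H : ℤ → ℤ} {s : BiWord} (hM : MarkoffCondition s)
    (hH : Counts H s) : NoJump H ∧ NoJump fun i => i - H i := by
  rw [markoffCondition_iff] at hM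
  -- `ε = 1` for an occurrence of `ab` and `ε = -1` for an occurrence of `ba`.
  have key : ∀ (ε c : ℤ) (T : ℕ), ε = 1 ∨ ε = -1 → 1 ≤ T →
      (∀ t : ℕ, 1 ≤ t → t ≤ T → H (c + t) + H (c - t) - 2 * H c = ε) →
      H (c + T + 1) + H (c - T - 1) - 2 * H c ≠ 2 * ε := by
    intro ε c T hε hT hE hlast
    have step : ∀ t : ℕ, H (c + t + 1) + H (c - t - 1) - (H (c + t) + H (c - t))
        = (s (c + t)).weight - (s (c - 1 - t)).weight := by
      intro t
      have h1 := hH (c + t)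
      have h2 := hH (c - t - 1)
      have e₁ : c - (t : ℤ) - 1 + 1 = c - t := by ring
      have e₂ : c - (t : ℤ) - 1 = c - 1 - t := by ring
      rw [e₁] at h2
      rw [h1, h2, e₂]
      ring
    have h0 := step 0
    have h1 := hE 1 le_rfl hT
    simp only [Nat.cast_zero, add_zero, sub_zero, Nat.cast_one] at h0 h1
    have hT' := step T
    have h2 := hE T hT le_rfl
    have w1 := (s c).weight_mem
    have w2 := (s (c - 1)).weight_mem
    have w3 := (s (c + T)).weight_mem
    have w4 := (s (c - 1 - T)).weight_mem
    have e₁ : c - 2 - ((T - 1 : ℕ) : ℤ) = c - 1 - T := by omega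
    have e₂ : c + 1 + ((T - 1 : ℕ) : ℤ) = c + T := by omega
    refine hM c (T - 1) ?_ ?_ ⟨?_, ?_⟩
    · intro heq
      rw [heq] at h0
      omega
    · intro t ht
      have h3 := step (t + 1)
      have h4 := hE (t + 1) (by omega) (by omega)
      have h5 := hE (t + 2) (by omega) (by omega)
      have e₃ : c + ((t + 1 : ℕ) : ℤ) + 1 = c + (t + 2 : ℕ) := by push_cast; ring
      have e₄ : c - ((t + 1 : ℕ) : ℤ) - 1 = c - (t + 2 : ℕ) := by push_cast; ring
      have e₅ : c - 1 - ((t + 1 : ℕ) : ℤ) = c - 2 - t := by push_cast; ring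
      have e₆ : c + ((t + 1 : ℕ) : ℤ) = c + 1 + t := by push_cast; ring
      rw [e₃, e₄, e₅] at h3
      apply Letter.weight_injective
      rw [← e₆]
      omega
    · apply Letter.weight_injective
      rw [e₁]
      omega
    · apply Letter.weight_injective
      rw [e₂]
      omega
  refine ⟨fun c T hT hE => ?_, fun c T hT hE => ?_⟩
  · simpa using key 1 c T (Or.inl rfl) hT hE
  · have h1 := key (-1) c T (Or.inr rfl) hT fun t h1 h2 => by
      have := hE t h1 h2
      dsimp only at this
      omega
    dsimp only
    omega

theorem markoffCondition_of_balanced {H : ℤ → ℤ} {s : BiWord} (hH : Counts H s)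
    (hb : ∀ l, BalancedAt H l) : MarkoffCondition s := by
  rw [markoffCondition_iff]
  rintro c T hc hT ⟨hx, hy⟩
  have hpal : ∀ t ≤ T, H (c + 1 + t) - H (c + 1) = H (c - 1) - H (c - 1 - t) := by
    intro t
    induction t with
    | zero => simp
    | succ t ih =>
      intro ht
      have ih := ih (by omega)
      have h1 := hH (c + 1 + t)
      have h2 := hH (c - 2 - t)
      have h3 := hT t (by omega)
      have e₁ : c + 1 + ((t + 1 : ℕ) : ℤ) = c + 1 + t + 1 := by push_cast; ring
      have e₂ : c - 1 - ((t + 1 : ℕ) : ℤ) = c - 2 - t := by push_cast; ring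
      have e₃ : c - 2 - (t : ℤ) + 1 = c - 1 - t := by ring
      rw [e₃] at h2
      rw [e₁, e₂]
      rw [h3] at h2
      omega
  -- With `m` the common part, `x m̃ x` and `y m y` are factors, which contradicts balance.
  have h0 := hpal T le_rfl
  have h1 := hH (c - 1)
  have h2 := hH c
  have h3 := hH (c + 1 + T)
  have h4 := hH (c - 2 - T)
  have h5 := hb (T + 2) c (c - 2 - T)
  have h6 := hb (T + 2) (c - 2 - T) c
  have e₁ : c - 2 - (T : ℤ) + 1 = c - 1 - T := by ring
  have e₂ : c - 2 - (T : ℤ) + ((T + 2 : ℕ) : ℤ) = c := by push_cast; ring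
  have e₃ : c + ((T + 2 : ℕ) : ℤ) = c + 1 + T + 1 := by push_cast; ring
  have e₄ : c - 1 + 1 = c := by ring
  rw [e₂, e₃] at h5 h6
  rw [e₄] at h1
  rw [e₁, hx] at h4
  rw [hy] at h3
  have h7 : (s (c - 1)).weight ≠ (s c).weight := fun h => hc (Letter.weight_injective h)
  have w1 := (s c).weight_mem
  have w2 := (s (c - 1)).weight_mem
  omega

/-! ### Letter counts of finite words -/

theorem count_add_count (w : Word) : w.count Letter.a + w.count Letter.b = w.length := by
  induction w with
  | nil => rfl
  | cons x w ih => cases x <;> simp <;> omega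

theorem count_take_add_count_take {w : Word} {i : ℕ} (hi : i ≤ w.length) :
    (w.take i).count Letter.a + (w.take i).count Letter.b = i := by
  rw [count_add_count, List.length_take, min_eq_left hi]

theorem count_take_succ (w : Word) {i : ℕ} (hi : i < w.length) :
    ((w.take (i + 1)).count Letter.b : ℤ) = (w.take i).count Letter.b + w[i].weight := by
  rw [List.take_succ_eq_append_getElem hi, List.count_append]
  cases w[i] <;> simp [Letter.weight]

theorem count_take_mono (w : Word) (x : Letter) {i j : ℕ} (h : i ≤ j) :
    (w.take i).count x ≤ (w.take j).count x :=
  (List.take_sublist_take_left h).count_le x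

theorem Counts.sub_eq_count_right {H : ℤ → ℤ} {s : BiWord} (hH : Counts H s) {c : ℤ} {w : Word}
    (hw : ∀ (k : ℕ) (hk : k < w.length), s (c + k) = w[k]) (t : ℕ) (ht : t ≤ w.length) :
    H (c + t) - H c = (w.take t).count Letter.b := by
  induction t with
  | zero => simp
  | succ t ih =>
    have h1 := hH (c + t)
    rw [hw t ht] at h1
    rw [count_take_succ w ht, ← ih (by omega)]
    push_cast
    rw [← add_assoc, h1]
    ring

theorem Counts.sub_eq_count_left {H : ℤ → ℤ} {s : BiWord} (hH : Counts H s) {c : ℤ} {w : Word}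
    (hw : ∀ (k : ℕ) (hk : k < w.length), s (c - 1 - k) = w[k]) (t : ℕ) (ht : t ≤ w.length) :
    H c - H (c - t) = (w.take t).count Letter.b := by
  induction t with
  | zero => simp
  | succ t ih =>
    have h1 := hH (c - 1 - t)
    have e₁ : c - 1 - (t : ℤ) + 1 = c - t := by ring
    have e₂ : c - ((t + 1 : ℕ) : ℤ) = c - 1 - t := by push_cast; ring
    rw [hw t ht, e₁] at h1
    rw [count_take_succ w ht, ← ih (by omega), e₂]
    omega

theorem count_take_bma (m : Word) {t : ℕ} (h1 : 1 ≤ t) (h2 : t ≤ m.length + 1) :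
    (([Letter.b] ++ m ++ [Letter.a]).take t).count Letter.b =
      (([Letter.a] ++ m ++ [Letter.b]).take t).count Letter.b + 1 := by
  obtain ⟨t, rfl⟩ := Nat.exists_eq_add_of_le' h1
  have h : t ≤ m.length := by omega
  simp [List.take_append_of_le_length h]

/-! ### Christoffel words in terms of letter counts -/

theorem below_slopeSegment_iff {p q : ℕ} (hp : 0 < p) (z : ℝ × ℝ) :
    Below z (slopeSegment p q) ↔ 0 ≤ z.1 ∧ z.1 ≤ p ∧ z.2 * p ≤ z.1 * q := by
  have hp' : (0 : ℝ) < p := by exact_mod_cast hp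
  have hq' : (0 : ℝ) ≤ q := by positivity
  constructor
  · rintro ⟨y, hy, s, t, hs, ht, hst, h⟩
    have hx := congrArg Prod.fst h
    have hz := congrArg Prod.snd h
    simp only [Prod.smul_mk, smul_eq_mul, mul_zero, Prod.mk_add_mk, zero_add] at hx hz
    refine ⟨by rw [← hx]; positivity, by rw [← hx]; nlinarith, ?_⟩
    calc z.2 * p ≤ y * p := by gcongr
      _ = z.1 * q := by rw [← hx, ← hz]; ring
  · rintro ⟨h0, h1, h2⟩
    refine ⟨z.1 / p * q, ?_, 1 - z.1 / p, z.1 / p, ?_, by positivity, by ring, ?_⟩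
    · rw [div_mul_eq_mul_div, le_div_iff₀ hp']
      exact h2
    · rw [sub_nonneg, div_le_one hp']
      exact h1
    · ext
      · simp only [Prod.smul_mk, smul_eq_mul, mul_zero, Prod.mk_add_mk, zero_add]
        exact div_mul_cancel₀ _ hp'.ne'
      · simp

theorem vertex_mem_path {w : Word} (hw : w ≠ []) {i : ℕ} (hi : i ≤ w.length) :
    vertex w i ∈ path w := by
  have hpos := List.length_pos_iff.mpr hw
  rcases hi.lt_or_eq with h | rfl
  · exact ⟨i, h, left_mem_segment ℝ _ _⟩
  · refine ⟨w.length - 1, by omega, ?_⟩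
    rw [Nat.sub_add_cancel hpos]
    exact right_mem_segment ℝ _ _

theorem vertex_fst_add_snd {w : Word} {i : ℕ} (hi : i ≤ w.length) :
    (vertex w i).1 + (vertex w i).2 = i := by
  simp only [vertex]
  exact_mod_cast count_take_add_count_take hi

theorem eq_vertex_of_mem_path {w : Word} {z : ℝ × ℝ} (hz : z ∈ path w) {i : ℕ}
    (hi : z.1 + z.2 = i) : z = vertex w i := by
  obtain ⟨j, hj, s, t, hs, ht, hst, rfl⟩ := hz
  have h1 := vertex_fst_add_snd hj.le
  have h2 := vertex_fst_add_snd (Nat.succ_le_of_lt hj)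
  simp only [Prod.fst_add, Prod.snd_add, Prod.smul_fst, Prod.smul_snd, smul_eq_mul] at hi
  have h3 : (i : ℝ) = j + t := by
    push_cast at h2
    linear_combination (-1 : ℝ) * hi + s * h1 + t * h2 + j * hst
  obtain h4 | h4 : i = j ∨ i = j + 1 := by
    have h5 : (j : ℝ) ≤ i := by linarith
    have h6 : (i : ℝ) ≤ (j + 1 : ℕ) := by push_cast; linarith
    have h5 : j ≤ i := by exact_mod_cast h5
    have h6 : i ≤ j + 1 := by exact_mod_cast h6
    omega
  · subst h4
    obtain rfl : t = 0 := by linarith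
    obtain rfl : s = 1 := by linarith
    simp
  · subst h4
    obtain rfl : t = 1 := by push_cast at h3; linarith
    obtain rfl : s = 0 := by linarith
    simp

/-- The number of letters `x` in a prefix grows by at most one at a time. -/
theorem exists_count_take_eq (w : Word) (x : Letter) (i : ℕ) {k : ℕ}
    (hk : k < (w.take i).count x) : ∃ j < i, (w.take j).count x = k := by
  induction i with
  | zero => simp at hk
  | succ i ih =>
    by_cases h : k < (w.take i).count x
    · obtain ⟨j, hj, h⟩ := ih h
      exact ⟨j, by omega, h⟩
    · refine ⟨i, by omega, ?_⟩
      have h1 : (w.take (i + 1)).count x ≤ (w.take i).count x + 1 := by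
        rw [List.take_add_one, List.count_append]
        cases w[i]? with
        | none => simp
        | some y =>
          have := List.count_le_length (a := x) (l := [y])
          simpa using this
      omega

/-- The path of a Christoffel word is the highest one below the segment: its vertex on the
antidiagonal `X + Y = i` has ordinate `⌊i * q / (p + q)⌋`. -/
theorem EncodesLowerPath.count_bounds {w : Word} {p q : ℕ} (h : EncodesLowerPath w p q)
    (hp : 0 < p) {i : ℕ} (hi : i ≤ w.length) :
    (w.take i).count Letter.b * w.length ≤ i * q ∧
      i * q < ((w.take i).count Letter.b + 1) * w.length := by
  have hend := h.endpoint
  simp only [vertex, List.take_length, Prod.mk.injEq, Nat.cast_inj] at hend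
  have hn : p + q = w.length := by rw [← hend.1, ← hend.2, count_add_count]
  have hw : w ≠ [] := by
    rintro rfl
    simp at hn
    omega
  have hAB := count_take_add_count_take hi
  have hlow : ∀ j ≤ w.length,
      (w.take j).count Letter.b * p ≤ (w.take j).count Letter.a * q := by
    intro j hj
    have h1 := ((below_slopeSegment_iff hp _).1 (h.below _ (vertex_mem_path hw hj))).2.2
    simp only [vertex] at h1
    exact_mod_cast h1
  set A := (w.take i).count Letter.a with hA
  set B := (w.take i).count Letter.b with hB
  rw [← hn]
  refine ⟨?_, ?_⟩
  · have := hlow i hi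
    rw [← hAB]
    nlinarith
  · by_contra hcon
    push Not at hcon
    -- Otherwise `(A - 1, B + 1)` is a lattice point of the region that is not on the path.
    have hA0 : 1 ≤ A := by
      by_contra hA0
      have hiB : i = B := by omega
      rw [hiB] at hcon
      nlinarith
    have hslope : (B + 1) * p ≤ (A - 1) * q := by
      obtain ⟨A', hA'⟩ := Nat.exists_eq_add_of_le' hA0
      rw [hA', Nat.add_sub_cancel]
      rw [← hAB, hA'] at hcon
      nlinarith
    obtain ⟨j, hj, hjA⟩ := exists_count_take_eq w Letter.a i (k := A - 1) (by omega)
    have hjB := count_take_mono w Letter.b hj.le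
    have hAp : A ≤ p := by
      rw [← hend.1]
      exact (List.take_sublist i w).count_le _
    have hcast : (((A : ℤ) - 1 : ℤ) : ℝ) = ((A - 1 : ℕ) : ℝ) := by
      rw [Nat.cast_sub hA0]
      push_cast
      ring
    have hmem := h.no_other_points ((A : ℤ) - 1) ((B : ℤ) + 1) ⟨?_, ?_⟩
    · have h1 := eq_vertex_of_mem_path hmem (i := i) (by
        rw [← hAB]
        push_cast
        ring)
      have h2 := congrArg Prod.snd h1
      simp only [vertex] at h2
      rw [← hB] at h2
      push_cast at h2
      linarith
    · refine ⟨(w.take j).count Letter.b, ?_, ?_⟩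
      · have h1 : (((w.take j).count Letter.b : ℕ) : ℝ) ≤ (B : ℝ) := by exact_mod_cast hjB
        push_cast
        linarith
      · rw [hcast, ← hjA]
        exact vertex_mem_path hw (by omega)
    · rw [below_slopeSegment_iff hp]
      refine ⟨?_, ?_, ?_⟩
      · rw [hcast]
        positivity
      · rw [hcast]
        have h1 : ((A - 1 : ℕ) : ℝ) ≤ p := by exact_mod_cast (by omega : A - 1 ≤ p)
        exact h1
      · rw [hcast]
        push_cast
        exact_mod_cast hslope

theorem encodesLowerPath_of_count_bounds {w : Word}
    (hp : 0 < w.count Letter.a)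
    (h : ∀ i ≤ w.length, (w.take i).count Letter.b * w.length ≤ i * w.count Letter.b ∧
      i * w.count Letter.b < ((w.take i).count Letter.b + 1) * w.length) :
    EncodesLowerPath w (w.count Letter.a) (w.count Letter.b) := by
  have hn := count_add_count w
  have hw : w ≠ [] := by
    rintro rfl
    simp at hp
  set p := w.count Letter.a with hpdef
  set q := w.count Letter.b with hqdef
  have hvert : ∀ i ≤ w.length, 0 ≤ (vertex w i).1 ∧ (vertex w i).1 ≤ p ∧
      (vertex w i).2 * p ≤ (vertex w i).1 * q := by
    intro i hi
    simp only [vertex]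
    refine ⟨by positivity, ?_, ?_⟩
    · exact_mod_cast (List.take_sublist i w).count_le _
    · have h1 := (h i hi).1
      have h2 := count_take_add_count_take hi
      rw [← hn, ← h2] at h1
      rw [h2] at h1
      have h3 : (w.take i).count Letter.b * p ≤ (w.take i).count Letter.a * q := by
        nlinarith
      exact_mod_cast h3
  refine ⟨by simp [vertex, hpdef, hqdef], ?_, ?_⟩
  · rintro z ⟨i, hi, s, t, hs, ht, hst, rfl⟩
    rw [below_slopeSegment_iff hp]
    obtain ⟨a0, a1, a2⟩ := hvert i hi.le
    obtain ⟨b0, b1, b2⟩ := hvert (i + 1) hi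
    simp only [Prod.fst_add, Prod.snd_add, Prod.smul_fst, Prod.smul_snd, smul_eq_mul]
    refine ⟨by positivity, ?_, ?_⟩
    · calc _ ≤ s * p + t * p := by gcongr
        _ = p := by rw [← add_mul, hst, one_mul]
    · have := mul_le_mul_of_nonneg_left a2 hs
      have := mul_le_mul_of_nonneg_left b2 ht
      linarith
  · rintro X Y ⟨⟨y, hyY, j, hj, s, t, hs, ht, hst, hz⟩, hbel⟩
    rw [below_slopeSegment_iff hp] at hbel
    obtain ⟨hX0, hXp, hslope⟩ := hbel
    have hx := congrArg Prod.fst hz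
    have hy := congrArg Prod.snd hz
    simp only [vertex, Prod.smul_mk, smul_eq_mul, Prod.mk_add_mk] at hx hy hyY hX0 hXp hslope
    have hA : (((w.take j).count Letter.a : ℕ) : ℝ) ≤ ((w.take (j + 1)).count Letter.a : ℕ) := by
      exact_mod_cast count_take_mono w _ (Nat.le_succ j)
    have hB : (((w.take j).count Letter.b : ℕ) : ℝ) ≤ ((w.take (j + 1)).count Letter.b : ℕ) := by
      exact_mod_cast count_take_mono w _ (Nat.le_succ j)
    -- The path passes below `(X, Y)` on its step number `j`.
    have hXle : (X : ℝ) ≤ ((w.take (j + 1)).count Letter.a : ℕ) := by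
      rw [← hx]
      nlinarith
    have hYge : (((w.take j).count Letter.b : ℕ) : ℝ) ≤ Y := by
      refine le_trans ?_ hyY
      rw [← hy]
      nlinarith
    obtain ⟨X, rfl⟩ := Int.eq_ofNat_of_zero_le (a := X) (by exact_mod_cast hX0)
    obtain ⟨Y, rfl⟩ := Int.eq_ofNat_of_zero_le (a := Y) (by
      have : (0 : ℝ) ≤ Y := le_trans (by positivity) hYge
      exact_mod_cast this)
    have hXle : X ≤ (w.take (j + 1)).count Letter.a := by exact_mod_cast hXle
    have hYge : (w.take j).count Letter.b ≤ Y := by exact_mod_cast hYge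
    have hXp : X ≤ p := by exact_mod_cast hXp
    have hslope : Y * p ≤ X * q := by exact_mod_cast hslope
    have hYq : Y ≤ q := by
      refine le_of_mul_le_mul_right (hslope.trans ?_) hp
      rw [mul_comm q p]
      exact Nat.mul_le_mul_right q hXp
    have hi : X + Y ≤ w.length := by omega
    obtain ⟨h1, h2⟩ := h (X + Y) hi
    have h3 := count_take_add_count_take hi
    have hYle : Y ≤ (w.take (X + Y)).count Letter.b := by
      by_contra hcon
      have h4 : ((w.take (X + Y)).count Letter.b + 1) * w.length ≤ Y * w.length :=
        Nat.mul_le_mul_right _ (by omega)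
      rw [← hn] at h2 h4
      nlinarith
    have hYeq : (w.take (X + Y)).count Letter.b = Y := by
      by_contra hcon
      have h4 : X + Y < j + 1 := by
        by_contra h5
        have := count_take_mono w Letter.a (not_lt.1 h5)
        omega
      have := count_take_mono w Letter.b (Nat.le_of_lt_succ h4)
      omega
    have hXeq : (w.take (X + Y)).count Letter.a = X := by omega
    have := vertex_mem_path hw hi
    simp only [vertex, hXeq, hYeq] at this
    simpa using this

/-- If the bounds of `encodesLowerPath_of_count_bounds` are strict before the end, then the
segment contains no lattice points between its end points, so that its slope is reduced. -/
theorem isChristoffelWord_of_count_bounds {w : Word} (hp : 0 < w.count Letter.a)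
    (h : ∀ i, 1 ≤ i → i < w.length →
      (w.take i).count Letter.b * w.length < i * w.count Letter.b ∧
      i * w.count Letter.b < ((w.take i).count Letter.b + 1) * w.length) :
    IsChristoffelWord w := by
  have hn := count_add_count w
  refine ⟨_, _, ?_, encodesLowerPath_of_count_bounds hp fun i hi => ?_⟩
  · by_contra hg
    rw [Nat.coprime_iff_gcd_eq_one] at hg
    have hg0 : 0 < Nat.gcd (w.count Letter.a) (w.count Letter.b) := Nat.gcd_pos_of_pos_left _ hp
    obtain ⟨p', hp'⟩ := Nat.gcd_dvd_left (w.count Letter.a) (w.count Letter.b)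
    obtain ⟨q', hq'⟩ := Nat.gcd_dvd_right (w.count Letter.a) (w.count Letter.b)
    set g := Nat.gcd (w.count Letter.a) (w.count Letter.b)
    have hp0 : 0 < p' := by
      rcases Nat.eq_zero_or_pos p' with rfl | h0
      · omega
      · exact h0
    -- `(p', q')` would be such a lattice point.
    have hlen : w.length = g * (p' + q') := by rw [← hn, mul_add, ← hp', ← hq']
    have hlt : p' + q' < w.length := by
      rw [hlen]
      nlinarith [show 2 ≤ g by omega]
    obtain ⟨h1, h2⟩ := h (p' + q') (by omega) hlt
    rw [hlen, hq'] at h1 h2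
    have hpos : 0 < g * (p' + q') := by positivity
    have h3 : (w.take (p' + q')).count Letter.b < q' := by
      refine lt_of_mul_lt_mul_right ?_ hpos.le
      calc _ < _ := h1
        _ = _ := by ring
    have h4 : q' < (w.take (p' + q')).count Letter.b + 1 := by
      refine lt_of_mul_lt_mul_right ?_ hpos.le
      calc _ = _ := by ring
        _ < _ := h2
    omega
  · rcases Nat.eq_zero_or_pos i with rfl | hi0
    · simp only [List.take_zero, List.count_nil]
      omega
    · rcases hi.lt_or_eq with hlt | rfl
      · exact ⟨(h i hi0 hlt).1.le, (h i hi0 hlt).2⟩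
      · rw [List.take_length]
        constructor <;> nlinarith

/-! ### Balanced words contain `m` only in Christoffel words -/

/-- The sum of the increments of `H` over the windows of length `t` starting at `a, …, a + n - 1`
is also the sum of its increments over the windows of length `n` starting at
`a, …, a + t - 1`. -/
theorem sum_windows_comm (H : ℤ → ℤ) (a : ℤ) (n t : ℕ) :
    ∑ j ∈ Finset.range n, (H (a + j + t) - H (a + j)) =
      ∑ r ∈ Finset.range t, (H (a + r + n) - H (a + r)) := by
  induction t with
  | zero => simp
  | succ t ih =>
    rw [Finset.sum_range_succ, ← ih]
    have h := Finset.sum_range_sub (fun j : ℕ => H (a + t + j)) n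
    have e : a + (t : ℤ) + ((0 : ℕ) : ℤ) = a + t := by simp
    rw [e] at h
    rw [← h, ← Finset.sum_add_distrib]
    refine Finset.sum_congr rfl fun j _ => ?_
    have e₁ : a + (j : ℤ) + ((t + 1 : ℕ) : ℤ) = a + t + (j + 1 : ℕ) := by push_cast; ring
    have e₂ : a + (j : ℤ) + t = a + t + j := by ring
    rw [e₁, e₂]
    ring

/-- Let `f t` be the number of letters `b` in the `t` letters following the position `c`, and
suppose that the `t` letters preceding `c` contain `f t + 1` of them for `1 ≤ t < n` and `f n` for
`t = n`. In a balanced word all factors of length `t` then contain `f t` or `f t + 1` letters `b`.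
Both values occur among `n` windows whose contents add up to `t * f n`. -/
theorem strict_bounds_of_balanced {H : ℤ → ℤ} (hb : ∀ l, BalancedAt H l) {c : ℤ} {n : ℕ}
    {f : ℕ → ℤ} (hR : ∀ t ≤ n, H (c + t) - H c = f t)
    (hL : ∀ t, 1 ≤ t → t < n → H c - H (c - t) = f t + 1) (hn : H c - H (c - n) = f n)
    {t : ℕ} (ht : 1 ≤ t) (htn : t < n) :
    f t * n < t * f n ∧ t * f n < (f t + 1) * n := by
  -- Otherwise the factor of length `n - r` at `c - n` contains two letters `b` less than the one
  -- ending at `c`.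
  have hpal : ∀ r, 1 ≤ r → r < n → f r + f (n - r) = f n - 1 := by
    intro r hr hrn
    have h1 := hb (n - r) (c - (n - r : ℕ)) (c - n)
    have h2 := hb (n - r) (c + r) c
    have e₁ : c - ((n - r : ℕ) : ℤ) + ((n - r : ℕ) : ℤ) = c := by ring
    have e₂ : c - (n : ℤ) + ((n - r : ℕ) : ℤ) = c - r := by omega
    have e₃ : c + (r : ℤ) + ((n - r : ℕ) : ℤ) = c + n := by omega
    rw [e₁, e₂] at h1
    rw [e₃] at h2
    have h3 := hR r hrn.le
    have h4 := hR (n - r) (by omega)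
    have h5 := hR n le_rfl
    have h6 := hL r hr hrn
    have h7 := hL (n - r) (by omega) (by omega)
    omega
  have hsum : ∑ j ∈ Finset.range n, (H (c - t + j + t) - H (c - t + j)) = t * f n := by
    rw [sum_windows_comm]
    have : ∀ r ∈ Finset.range t, H (c - t + r + n) - H (c - t + r) = f n := by
      intro r hr
      rw [Finset.mem_range] at hr
      have h1 := hpal (t - r) (by omega) (by omega)
      have h2 := hL (t - r) (by omega) (by omega)
      have h3 := hR (n - (t - r)) (by omega)
      have e₁ : c - (t : ℤ) + r + n = c + (n - (t - r) : ℕ) := by omega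
      have e₂ : c - (t : ℤ) + r = c - (t - r : ℕ) := by omega
      rw [e₁, e₂]
      omega
    rw [Finset.sum_congr rfl this]
    simp
  have hRt := hR t htn.le
  have hLt := hL t ht htn
  have e : ∀ j : ℤ, c - (t : ℤ) + j + t = c + j := fun j => by ring
  have e' : c - (t : ℤ) + t = c := by ring
  have hlow : ∀ j ∈ Finset.range n, f t ≤ H (c - t + j + t) - H (c - t + j) := by
    intro j _
    have := hb t (c - t) (c - t + j)
    rw [e'] at this
    omega
  have hup : ∀ j ∈ Finset.range n, H (c - t + j + t) - H (c - t + j) ≤ f t + 1 := by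
    intro j _
    have := hb t (c - t + j) c
    omega
  constructor
  · have := Finset.sum_lt_sum hlow ⟨0, Finset.mem_range.2 (by omega), by
      simp only [Nat.cast_zero, add_zero]
      rw [e']
      omega⟩
    rw [hsum] at this
    simpa [mul_comm] using this
  · have := Finset.sum_lt_sum hup ⟨t, Finset.mem_range.2 htn, by
      rw [e']
      omega⟩
    rw [hsum] at this
    simpa [mul_comm] using this

theorem isChristoffelWord_of_balanced {H : ℤ → ℤ} (hb : ∀ l, BalancedAt H l) {c : ℤ} {m : Word}
    (hR : ∀ t ≤ m.length + 2,
      H (c + t) - H c = (([Letter.a] ++ m ++ [Letter.b]).take t).count Letter.b)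
    (hL : ∀ t ≤ m.length + 2,
      H c - H (c - t) = (([Letter.b] ++ m ++ [Letter.a]).take t).count Letter.b) :
    IsChristoffelWord ([Letter.a] ++ m ++ [Letter.b]) := by
  have hlen : ([Letter.a] ++ m ++ [Letter.b]).length = m.length + 2 := by simp
  have hlen' : ([Letter.b] ++ m ++ [Letter.a]).length = m.length + 2 := by simp
  refine isChristoffelWord_of_count_bounds (by simp) fun i hi hin => ?_
  rw [hlen] at hin ⊢
  have hfull : ([Letter.a] ++ m ++ [Letter.b]).take (m.length + 2) =
      [Letter.a] ++ m ++ [Letter.b] := List.take_of_length_le hlen.le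
  have hfull' : ([Letter.b] ++ m ++ [Letter.a]).take (m.length + 2) =
      [Letter.b] ++ m ++ [Letter.a] := List.take_of_length_le hlen'.le
  have := strict_bounds_of_balanced hb hR (fun t h1 h2 => by
    rw [hL t h2.le, count_take_bma m h1 (by omega)]
    push_cast
    rfl) (by
    rw [hL _ le_rfl, hfull, hfull']
    simp) hi hin
  rw [hfull] at this
  exact_mod_cast this

theorem isChristoffelWord_of_isMarkoffWord {m : Word} (h : IsMarkoffWord m) :
    IsChristoffelWord ([Letter.a] ++ m ++ [Letter.b]) := by
  obtain ⟨s, hs, x, y, hxy, u, v, i, -, hw, -⟩ := h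
  obtain ⟨H, hH⟩ := exists_counts s
  have hb := balancedAt_of_noJump hH.unitSteps (hs.noJump hH).1 (hs.noJump hH).2
  have hlen : ∀ x y : Letter, ([x] ++ m ++ [y]).length = m.length + 2 := by
    intro x y
    simp
  have hfac : [y] ++ m.reverse ++ [x, y] ++ m ++ [x] =
      ([x] ++ m ++ [y]).reverse ++ ([y] ++ m ++ [x]) := by simp
  simp only [hfac] at hw
  have hright : ∀ (k : ℕ) (hk : k < ([y] ++ m ++ [x]).length),
      s (i + (m.length + 2 : ℕ) + k) = ([y] ++ m ++ [x])[k] := by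
    intro k hk
    have := hw (m.length + 2 + k) (by
      rw [List.length_append, List.length_reverse, hlen]
      omega)
    rw [List.getElem_append_right (by rw [List.length_reverse, hlen]; omega)] at this
    simp only [List.length_reverse, hlen, Nat.add_sub_cancel_left] at this
    rw [this]
    congr 1
    push_cast
    ring
  have hleft : ∀ (k : ℕ) (hk : k < ([x] ++ m ++ [y]).length),
      s (i + (m.length + 2 : ℕ) - 1 - k) = ([x] ++ m ++ [y])[k] := by
    intro k hk
    have hk' := hk
    rw [hlen] at hk'
    have := hw (m.length + 2 - 1 - k) (by
      rw [List.length_append, List.length_reverse, hlen]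
      omega)
    rw [List.getElem_append_left (by rw [List.length_reverse, hlen]; omega),
      List.getElem_reverse] at this
    simp only [hlen] at this
    have e : i + ((m.length + 2 : ℕ) : ℤ) - 1 - k = i + (m.length + 2 - 1 - k : ℕ) := by omega
    rw [e, ← this]
    congr 1
    omega
  have hR := hH.sub_eq_count_right hright
  have hL := hH.sub_eq_count_left hleft
  simp only [hlen] at hR hL
  cases x <;> cases y
  · exact absurd rfl hxy
  · -- Here `amb` is read from right to left.
    refine isChristoffelWord_of_balanced (fun l => (hb l).reflect)
      (c := -(i + (m.length + 2 : ℕ))) (fun t ht => ?_) (fun t ht => ?_)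
    · rw [← hL t ht]
      have e : -(-(i + ((m.length + 2 : ℕ) : ℤ)) + t) = i + (m.length + 2 : ℕ) - t := by ring
      rw [e, neg_neg]
      ring
    · rw [← hR t ht]
      have e : -(-(i + ((m.length + 2 : ℕ) : ℤ)) - t) = i + (m.length + 2 : ℕ) + t := by ring
      rw [e, neg_neg]
      ring
  · exact isChristoffelWord_of_balanced hb hR hL
  · exact absurd rfl hxy

/-! ### The periodic word of a Christoffel word -/

/-- The bi-infinite word of slope `q / n`: the letter at the position `i` is `b` if and only if
`⌊i * q / n⌋` increases there. For `q` and `n` coprime it is the periodic repetition of a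
Christoffel word. -/
def mechanicalWord (q n : ℤ) : BiWord :=
  fun i => if (i + 1) * q / n = i * q / n then Letter.a else Letter.b

theorem counts_mechanicalWord {q n : ℤ} (hn : 0 < n) (hq : 0 ≤ q) (hqn : q ≤ n) :
    Counts (fun i => i * q / n) (mechanicalWord q n) := by
  intro i
  have h1 : i * q / n ≤ (i + 1) * q / n := Int.ediv_le_ediv hn (by linarith)
  have h2 : (i + 1) * q / n ≤ i * q / n + 1 := by
    rw [← Int.add_mul_ediv_right _ _ hn.ne']
    exact Int.ediv_le_ediv hn (by linarith)
  unfold mechanicalWord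
  dsimp only
  split_ifs with h
  · simp [Letter.weight, h]
  · simp only [Letter.weight]
    omega

theorem balancedAt_mechanical {q n : ℤ} (hn : 0 < n) (l : ℕ) :
    BalancedAt (fun i => i * q / n) l := by
  have key : ∀ i : ℤ, l * q / n ≤ (i + l) * q / n - i * q / n ∧
      (i + l) * q / n - i * q / n ≤ l * q / n + 1 := by
    intro i
    have h1 := Int.mul_ediv_add_emod (i * q) n
    have h2 := Int.mul_ediv_add_emod (l * q) n
    have h3 := Int.mul_ediv_add_emod ((i + l) * q) n
    have h4 := Int.emod_nonneg (i * q) hn.ne'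
    have h5 := Int.emod_nonneg (l * q) hn.ne'
    have h6 := Int.emod_nonneg ((i + l) * q) hn.ne'
    have h7 := Int.emod_lt_of_pos (i * q) hn
    have h8 := Int.emod_lt_of_pos (l * q) hn
    have h9 := Int.emod_lt_of_pos ((i + l) * q) hn
    constructor
    · have : n * (l * q / n + i * q / n) < n * ((i + l) * q / n + 1) := by nlinarith
      have := lt_of_mul_lt_mul_left this hn.le
      omega
    · have : n * ((i + l) * q / n) < n * (l * q / n + i * q / n + 2) := by nlinarith
      have := lt_of_mul_lt_mul_left this hn.le
      omega
  intro i j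
  have := key i
  have := key j
  dsimp only
  omega

theorem isMarkoffWord_of_isChristoffelWord {m : Word}
    (h : IsChristoffelWord ([Letter.a] ++ m ++ [Letter.b])) : IsMarkoffWord m := by
  obtain ⟨p, q, hpq, h⟩ := h
  set w := [Letter.a] ++ m ++ [Letter.b] with hw
  have hlen : w.length = m.length + 2 := by
    rw [hw]
    simp
  have hend := h.endpoint
  simp only [vertex, List.take_length, Prod.mk.injEq, Nat.cast_inj] at hend
  have hp : 0 < p := by
    rw [← hend.1, hw]
    simp
  have hn : p + q = w.length := by rw [← hend.1, ← hend.2, count_add_count]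
  set n := w.length
  have hn0 : (0 : ℤ) < n := by omega
  have hfloor : ∀ i ≤ n, ((w.take i).count Letter.b : ℤ) = i * q / n := by
    intro i hi
    obtain ⟨h1, h2⟩ := h.count_bounds hp hi
    symm
    rw [Int.ediv_eq_iff_of_pos hn0]
    constructor
    · exact_mod_cast h1
    · have h3 : (i * q : ℤ) < ((w.take i).count Letter.b + 1) * n := by exact_mod_cast h2
      linarith
  set s := mechanicalWord q n
  have hc : Counts (fun i => i * q / n) s :=
    counts_mechanicalWord hn0 (by positivity) (by omega)
  have hsw : ∀ (k : ℕ) (hk : k < n), s k = w[k] := by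
    intro k hk
    apply Letter.weight_injective
    have h1 := count_take_succ w hk
    have h2 := hc k
    dsimp only at h2
    have h3 := hfloor (k + 1) hk
    have h4 := hfloor k hk.le
    push_cast at h3
    omega
  have hper : ∀ k : ℤ, s (n + k) = s k := by
    intro k
    have e : ∀ i : ℤ, (n + i) * q / n = i * q / n + q := by
      intro i
      rw [add_mul, mul_comm (n : ℤ) q, add_comm, Int.add_mul_ediv_right _ _ hn0.ne']
    simp only [s, mechanicalWord, add_assoc, e, add_left_inj]
  -- For `0 < i < n` the quotient `i * q / n` is not an integer, so the floor of its opposite is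
  -- one less than the opposite of its floor.
  have hrefl : ∀ i : ℤ, 0 < i → i < n → (n - i) * q / n = q - 1 - i * q / n := by
    intro i hi hin
    have hndvd : ¬ (n : ℤ) ∣ i * q := by
      intro hd
      have hcop : IsCoprime (n : ℤ) q := by
        rw [Nat.isCoprime_iff_coprime, ← hn]
        simpa using hpq
      have := Int.le_of_dvd hi (hcop.dvd_of_dvd_mul_right hd)
      omega
    have h1 := Int.mul_ediv_add_emod (i * q) n
    have h2 := Int.emod_lt_of_pos (i * q) hn0
    have h3 := Int.emod_pos_of_not_dvd hndvd
    have h3 : 0 < i * q % n := by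
      have := Int.emod_nonneg (i * q) hn0.ne'
      omega
    rw [Int.ediv_eq_iff_of_pos hn0]
    constructor <;> nlinarith
  have hpal : m.reverse = m := by
    refine List.ext_getElem (by simp) fun k hk hk' => ?_
    rw [List.getElem_reverse]
    have hm : ∀ (j : ℕ) (hj : j < m.length), m[j] = s (j + 1) := by
      intro j hj
      have h1 := hsw (j + 1) (by omega)
      push_cast at h1
      rw [h1]
      simp [hw, List.getElem_append_left, hj]
    rw [hm, hm _ hk']
    apply Letter.weight_injective
    have h1 := hc ((m.length - 1 - k : ℕ) + 1)
    have h2 := hc (k + 1)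
    dsimp only at h1 h2
    have h3 := hrefl (k + 1) (by omega) (by omega)
    have h4 := hrefl (k + 1 + 1) (by omega) (by omega)
    have e₁ : (((m.length - 1 - k : ℕ) : ℤ) + 1) = n - (k + 1 + 1) := by omega
    have e₂ : (n : ℤ) - (k + 1 + 1) + 1 = n - (k + 1) := by ring
    rw [e₁, e₂] at h1
    rw [e₁]
    omega
  refine ⟨s, markoffCondition_of_balanced hc (balancedAt_mechanical hn0), Letter.b, Letter.a,
    by decide, fun k => s (0 - 1 - k), fun k => s (0 + (w ++ w).length + k), 0, fun k => rfl, ?_, ?_⟩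
  · have hfac : [Letter.a] ++ m.reverse ++ [Letter.b, Letter.a] ++ m ++ [Letter.b] = w ++ w := by
      rw [hpal, hw]
      simp
    simp only [hfac]
    intro k hk
    rw [List.length_append] at hk
    rw [zero_add]
    by_cases hkn : k < n
    · rw [List.getElem_append_left hkn, hsw k hkn]
    · rw [List.getElem_append_right (by omega), ← hsw _ (by omega), ← hper]
      congr 1
      omega
  · intro k
    have hfac : [Letter.a] ++ m.reverse ++ [Letter.b, Letter.a] ++ m ++ [Letter.b] = w ++ w := by
      rw [hpal, hw]
      simp
    rw [hfac]
    rfl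

end MarkoffWords

theorem mainTheorem2 (m : MarkoffWords.Word) :
    MarkoffWords.IsMarkoffWord m ↔
      MarkoffWords.IsChristoffelWord ([MarkoffWords.Letter.a] ++ m ++ [MarkoffWords.Letter.b]) :=
  ⟨MarkoffWords.isChristoffelWord_of_isMarkoffWord,
    MarkoffWords.isMarkoffWord_of_isChristoffelWord⟩
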